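/- **Setting.** Let $d\ge 1$ and let $\Omega\subset\mathbb R^d$ be compact, equal to the closure of its interior, with $\operatorname{int}\Omega$ uniformly locally quasiconvex: there are $r>0$, $C\ge1$ such that any $x,y\in\operatorname{int}\Omega$ with $|y-x|\le r$ are joined by a curve $c\colon[0,1]\to\operatorname{int}\Omega$ with Lipschitz constant at most $C|y-x|$. Let $Y$ be a separable real Hilbert space, $L\colon Y\to\mathbb R$ of class $C^2$, $k\in C^{1,\gamma_0}(\Omega;Y)$ for some $\gamma_0\in(0,1]$, and $\alpha>0$. Let $\mathcal M(\Omega)=C(\Omega)^*$ be the space of Radon measures with its dual norm $\|\cdot\|_{\mathcal M}$, and put $Ku=\int_\Omega k\,du$ and $J(u)=L(Ku)+\alpha\|u\|_{\mathcal M}$ for $u\in\mathcal M(\Omega)$. Let $\|u\|_{BL}$ be the supremum of $\int_\Omega\varphi\,du$ over all $\varphi\colon\Omega\to\mathbb R$ with $\sup|\varphi|\le1$ and Lipschitz constant at most $1$. Let $C^1(\Omega)$ be the space of all $\varphi\in C(\Omega)$ that are continuously differentiable on $\operatorname{int}\Omega$ with $\nabla\varphi$ extending continuously to $\Omega$, normed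 by $\max\{\sup|\varphi|,\sup|\nabla\varphi|\}$, and let $C^1(\Omega)^*$ be its dual with the dual norm. For $u\in\mathcal M(\Omega)$, $v\in\mathcal M(\Omega;\mathbb R^d)=C(\Omega;\mathbb R^d)^*$ let $[u,v]\in C^1(\Omega)^*$ be the functional $\varphi\mapsto\int\varphi\,du+\int\nabla\varphi\cdot dv$; every element of $C^1(\Omega)^*$ is of this form. Define $\mathcal K\colon C^1(\Omega)^*\to Y$ and $G\colon C^1(\Omega)^*\to[0,\infty]$ by $$\mathcal K[u,v]=\int_\Omega k\,du+\int_\Omega Dk\,dv,\qquad G(h)=\begin{cases}\alpha\|u\|_{\mathcal M}&\text{if }h=[u,0]\text{ for some }u\in\mathcal M(\Omega),\\ \infty&\text{otherwise.}\end{cases}$$ For $x\in C^1(\Omega)^*$ with $G(x)<\infty$, $p\in C^1(\Omega)$ and $h\in C^1(\Omega)^*$, let $$G''(x,p;h)=\inf\Big\{\liminf_{n\to\infty}\frac{G(x+t_nh_n)-G(x)-t_n\langle p,h_n\rangle}{t_n^2/2}\ :\ t_n\searrow0,\ h_n\rightharpoonup^*h\Big\}\in[-\infty,\infty],$$ where the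 $t_n$ are positive and the $h_n$ lie in $C^1(\Omega)^*$. **Statement.** Let $\bar u\in\mathcal M(\Omega)$ and set $\bar p=-(k(\cdot),\nabla L(K\bar u))_Y\in C^1(\Omega)$. The following are equivalent. (a) One has $$(\mathcal Kh,\nabla^2L(K\bar u)\mathcal Kh)_Y+G''([\bar u,0],\bar p;h)>0\qquad\text{for all }h\in C^1(\Omega)^*\setminus\{0\},$$ and, for all sequences $t_n\searrow0$ in $(0,\infty)$ and $h_n\rightharpoonup^*0$ in $C^1(\Omega)^*$ with $\|h_n\|_{C^1(\Omega)^*}=1$ for all $n$, $$\liminf_{n\to\infty}\Big(\frac{1}{t_n^2}\big(G([\bar u,0]+t_nh_n)-G([\bar u,0])\big)-\frac1{t_n}\langle\bar p,h_n\rangle\Big)>0.$$ (b) There exist $\gamma>0$ and $\varepsilon>0$ such that $$J(u)-J(\bar u)\ge\gamma\|u-\bar u\|_{BL}^2\qquad\text{for all }u\in\mathcal M(\Omega)\text{ with }\|u-\bar u\|_{BL}\le\varepsilon.$$ -/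

import Mathlib

open Filter Topology MeasureTheory
open scoped NNReal

namespace LiftedMeasures

noncomputable section

/-- Euclidean space `ℝ^d`. -/
abbrev Euc (d : ℕ) : Type := EuclideanSpace ℝ (Fin d)

/-! ### Uniform local quasiconvexity -/

/-- `D` is uniformly locally quasiconvex: there are `r > 0` and `C ≥ 1` such that any two points
`x, y ∈ D` with `|y - x| ≤ r` are joined by a curve `[0,1] → D` whose Lipschitz constant is at
most `C |y - x|`. -/
def UniformlyLocallyQuasiconvex {d : ℕ} (D : Set (Euc d)) : Prop :=
  ∃ r : ℝ, 0 < r ∧ ∃ C : ℝ≥0, 1 ≤ C ∧ ∀ x ∈ D, ∀ y ∈ D, dist y x ≤ r →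
    ∃ c : ℝ → Euc d, c 0 = x ∧ c 1 = y ∧ (∀ s ∈ Set.Icc (0 : ℝ) 1, c s ∈ D) ∧
      LipschitzOnWith (C * nndist y x) c (Set.Icc (0 : ℝ) 1)

/-! ### Functions on a compact set `Ω ⊆ ℝ^d` -/

section Spaces

variable {d : ℕ} (Ω : TopologicalSpace.Compacts (Euc d))

/-- Extension by zero of a function on `Ω` to all of `ℝ^d`. It is only used to speak about
derivatives at interior points of `Ω`, where the extension plays no role. -/
def zeroExt {Ω : TopologicalSpace.Compacts (Euc d)} {F : Type*} [Zero F] (f : Ω → F) :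
    Euc d → F :=
  Function.extend Subtype.val f 0

theorem zeroExt_map {Ω : TopologicalSpace.Compacts (Euc d)} {F F' : Type*} [Zero F] [Zero F']
    (g : F → F') (hg : g 0 = 0) (f : Ω → F) :
    zeroExt (fun x => g (f x)) = fun z => g (zeroExt f z) := by
  classical
  funext z
  unfold zeroExt
  by_cases hz : ∃ a : Ω, a.1 = z
  · obtain ⟨a, rfl⟩ := hz
    rw [Subtype.val_injective.extend_apply, Subtype.val_injective.extend_apply]
  · rw [Function.extend_apply' _ _ _ hz, Function.extend_apply' _ _ _ hz]
    simp [hg]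

theorem zeroExt_add {Ω : TopologicalSpace.Compacts (Euc d)} {F : Type*} [AddZeroClass F]
    (f g : Ω → F) : zeroExt (fun x => f x + g x) = fun z => zeroExt f z + zeroExt g z := by
  classical
  funext z
  unfold zeroExt
  by_cases hz : ∃ a : Ω, a.1 = z
  · obtain ⟨a, rfl⟩ := hz
    simp only [Subtype.val_injective.extend_apply]
  · simp only [Function.extend_apply' _ _ _ hz]
    simp

/-- The pairs `(φ, ∇φ)` of a continuous function `φ` on `Ω` that is continuously differentiable on
`int Ω`, and a continuous extension to `Ω` of its gradient on `int Ω`. When `Ω` is the closure of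
its interior the second component is determined by the first. -/
def c1Submodule : Submodule ℝ (C(Ω, ℝ) × C(Ω, Euc d)) where
  carrier := {p | ∀ x : Ω, x.1 ∈ interior (Ω : Set (Euc d)) →
    HasGradientAt (zeroExt p.1) (p.2 x) x.1}
  zero_mem' := by
    intro x _
    have h : zeroExt (Ω := Ω) (fun _ => (0 : ℝ)) = fun _ => 0 :=
      zeroExt_map (fun _ : ℝ => (0 : ℝ)) rfl (fun _ : Ω => (0 : ℝ))
    change HasGradientAt (zeroExt (Ω := Ω) (fun _ => (0 : ℝ))) 0 x.1
    rw [h]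
    exact hasGradientAt_const _ _
  add_mem' := by
    intro p q hp hq x hx
    have h := (hp x hx).hasFDerivAt.add (hq x hx).hasFDerivAt
    change HasGradientAt (zeroExt (fun z => p.1 z + q.1 z)) (p.2 x + q.2 x) x.1
    rw [zeroExt_add, hasGradientAt_iff_hasFDerivAt, map_add]
    exact h
  smul_mem' := by
    intro c p hp x hx
    have h := (hp x hx).hasFDerivAt.const_smul c
    change HasGradientAt (zeroExt (fun z => c • p.1 z)) (c • p.2 x) x.1
    rw [zeroExt_map (fun r : ℝ => c • r) (smul_zero c), hasGradientAt_iff_hasFDerivAt,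
      map_smul]
    exact h

/-- The Banach space `C¹(Ω)` of continuous functions on `Ω` that are continuously differentiable on
`int Ω` and whose gradient extends continuously from `int Ω` to `Ω`. The norm, inherited from the
product, is `max (sup |φ|) (sup |∇φ|)`. -/
def C1 : Type := c1Submodule Ω

instance : NormedAddCommGroup (C1 Ω) := inferInstanceAs (NormedAddCommGroup (c1Submodule Ω))

instance : NormedSpace ℝ (C1 Ω) := inferInstanceAs (NormedSpace ℝ (c1Submodule Ω))

/-- The isometric embedding `φ ↦ (φ, ∇φ)` of `C¹(Ω)` into `C(Ω) × C(Ω; ℝ^d)`. -/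
def C1.incl : C1 Ω →ₗᵢ[ℝ] C(Ω, ℝ) × C(Ω, Euc d) where
  toFun φ := φ.1
  map_add' _ _ := rfl
  map_smul' _ _ := rfl
  norm_map' _ := rfl

/-- The space `𝓜(Ω)` of Radon measures: the topological dual space of `C(Ω)`, with its dual
norm. The pairing `⟨φ, u⟩ = ∫ φ du` is `u φ`. -/
abbrev Meas : Type := StrongDual ℝ C(Ω, ℝ)

/-- The space `𝓜(Ω; ℝ^d)` of vector-valued Radon measures: the topological dual space of
`C(Ω; ℝ^d)`. -/
abbrev VecMeas : Type := StrongDual ℝ C(Ω, Euc d)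

/-- The topological dual space `C¹(Ω)*`, with its dual norm. -/
abbrev C1Dual : Type := StrongDual ℝ (C1 Ω)

/-- A kernel of class `C^{1,γ}(Ω; Y)`: a continuous map `k : Ω → Y`, differentiable on `int Ω`,
whose derivative extends from `int Ω` to a `γ`-Hölder continuous map `Dk` on `Ω`. -/
structure C1HolderKernel (Y : Type*) [NormedAddCommGroup Y] [NormedSpace ℝ Y] (γ : ℝ≥0) where
  /-- the kernel itself -/
  toMap : C(Ω, Y)
  /-- the continuous extension of its derivative -/
  deriv : C(Ω, Euc d →L[ℝ] Y)
  hasFDerivAt_interior : ∀ x : Ω, x.1 ∈ interior (Ω : Set (Euc d)) →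
    HasFDerivAt (zeroExt toMap) (deriv x) x.1
  holder_deriv : ∃ C : ℝ≥0, HolderWith C γ deriv

end Spaces

section Operators

variable {d : ℕ} {Ω : TopologicalSpace.Compacts (Euc d)}
variable {Y : Type*} [NormedAddCommGroup Y] [InnerProductSpace ℝ Y] [CompleteSpace Y]

/-! ### The dual of `C¹(Ω)` -/

/-- The element `[u, v]` of `C¹(Ω)*` represented by the pair of measures `(u, v)`, acting by
`φ ↦ ⟨φ, u⟩ + ⟨∇φ, v⟩`. -/
def eqClass (u : Meas Ω) (v : VecMeas Ω) : C1Dual Ω :=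
  (ContinuousLinearMap.coprod u v).comp (C1.incl Ω).toContinuousLinearMap

theorem eqClass_apply (u : Meas Ω) (v : VecMeas Ω) (φ : C1 Ω) :
    eqClass u v φ = u φ.1.1 + v φ.1.2 := rfl

/-- Every bounded functional on `C¹(Ω)` is represented by a pair of measures. -/
theorem exists_eqClass (h : C1Dual Ω) : ∃ w : Meas Ω × VecMeas Ω, eqClass w.1 w.2 = h := by
  obtain ⟨g, hg, -⟩ := exists_extension_norm_eq (c1Submodule Ω) (h : StrongDual ℝ (c1Submodule Ω))
  refine ⟨(g.comp (ContinuousLinearMap.inl ℝ _ _), g.comp (ContinuousLinearMap.inr ℝ _ _)), ?_⟩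
  ext φ
  refine Eq.trans ?_ (hg φ)
  rw [eqClass_apply]
  simp [← map_add]

/-- The canonical injection `Π : 𝓜(Ω) → C¹(Ω)*`, `Π u = [u, 0]`. -/
def inj (u : Meas Ω) : C1Dual Ω := eqClass u 0

/-! ### Integration of vector-valued functions -/

/-- `y ↦ (f(·), y)_Y` as a bounded operator `Y → C(Ω)`. -/
def pairing (f : C(Ω, Y)) : Y →L[ℝ] C(Ω, ℝ) :=
  LinearMap.mkContinuous
    { toFun := fun y => ⟨fun x => inner ℝ (f x) y, by fun_prop⟩
      map_add' := fun y z => by ext x; simp [inner_add_right]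
      map_smul' := fun c y => by ext x; simp [inner_smul_right] }
    ‖f‖ (fun y => by
      refine (ContinuousMap.norm_le _ (by positivity)).2 fun x => ?_
      exact (norm_inner_le_norm _ _).trans (by gcongr; exact f.norm_coe_le_norm x))

/-- `y ↦ A(·)ᵀ y` as a bounded operator `Y → C(Ω; ℝ^d)`. -/
def adjPairing (A : C(Ω, Euc d →L[ℝ] Y)) : Y →L[ℝ] C(Ω, Euc d) :=
  LinearMap.mkContinuous
    { toFun := fun y => ⟨fun x => ContinuousLinearMap.adjoint (A x) y, by
        exact ((LinearIsometryEquiv.continuous ContinuousLinearMap.adjoint).comp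
          A.continuous).clm_apply continuous_const⟩
      map_add' := fun y z => by ext x; simp
      map_smul' := fun c y => by ext x; simp }
    ‖A‖ (fun y => by
      refine (ContinuousMap.norm_le _ (by positivity)).2 fun x => ?_
      refine (ContinuousLinearMap.le_opNorm _ _).trans ?_
      rw [LinearIsometryEquiv.norm_map]
      gcongr
      exact A.norm_coe_le_norm x)

/-- The integral `∫ f du ∈ Y` of `f ∈ C(Ω; Y)` against `u ∈ 𝓜(Ω)`, i.e. the element of `Y` with
`(∫ f du, y)_Y = ∫ (f(x), y)_Y du(x)` for all `y`. It is the Bochner integral, see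
`integral_eq_bochner`. -/
def integral (f : C(Ω, Y)) (u : Meas Ω) : Y :=
  (InnerProductSpace.toDual ℝ Y).symm (u.comp (pairing f))

/-- The integral `∫ A dv ∈ Y` of `A ∈ C(Ω; L(ℝ^d, Y))` against `v ∈ 𝓜(Ω; ℝ^d)`, i.e. the element
of `Y` with `(∫ A dv, y)_Y = ∫ A(x)ᵀ y · dv(x)` for all `y`. If `v = σ μ` with a finite measure `μ`
and a density `σ`, it is the Bochner integral `∫ A(x) σ(x) dμ(x)`, see
`vecIntegral_eq_bochner`. -/
def vecIntegral (A : C(Ω, Euc d →L[ℝ] Y)) (v : VecMeas Ω) : Y :=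
  (InnerProductSpace.toDual ℝ Y).symm (v.comp (adjPairing A))

theorem inner_integral (f : C(Ω, Y)) (u : Meas Ω) (y : Y) :
    inner ℝ (integral f u) y = u (pairing f y) := by
  simp [integral]

theorem inner_vecIntegral (A : C(Ω, Euc d →L[ℝ] Y)) (v : VecMeas Ω) (y : Y) :
    inner ℝ (vecIntegral A v) y = v (adjPairing A y) := by
  simp [vecIntegral]

theorem vecIntegral_eq_bochner (A : C(Ω, Euc d →L[ℝ] Y)) (v : VecMeas Ω) (μ : Measure Ω)
    [IsFiniteMeasure μ] (σ : Ω → Euc d) (hσ : Integrable σ μ)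
    (hv : ∀ ψ : C(Ω, Euc d), v ψ = ∫ x, inner ℝ (σ x) (ψ x) ∂μ) :
    vecIntegral A v = ∫ x, A x (σ x) ∂μ := by
  have hint : Integrable (fun x => A x (σ x)) μ := by
    refine Integrable.mono' (hσ.norm.const_mul ‖A‖) ?_ ?_
    · exact (ContinuousLinearMap.apply ℝ Y).aestronglyMeasurable_comp₂ hσ.aestronglyMeasurable
        A.continuous.aestronglyMeasurable
    · refine Eventually.of_forall fun x => ?_
      refine ((A x).le_opNorm _).trans ?_
      gcongr
      exact A.norm_coe_le_norm x
  refine ext_inner_right ℝ fun y => ?_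
  rw [inner_vecIntegral, hv, real_inner_comm, ← integral_inner hint]
  refine integral_congr_ae (Eventually.of_forall fun x => ?_)
  change inner ℝ (σ x) (ContinuousLinearMap.adjoint (A x) y) = inner ℝ y (A x (σ x))
  rw [ContinuousLinearMap.adjoint_inner_right, real_inner_comm]

theorem integral_eq_bochner (f : C(Ω, Y)) (u : Meas Ω) (μ ν : Measure Ω)
    [IsFiniteMeasure μ] [IsFiniteMeasure ν]
    (hu : ∀ φ : C(Ω, ℝ), u φ = ∫ x, φ x ∂μ - ∫ x, φ x ∂ν) :
    integral f u = ∫ x, f x ∂μ - ∫ x, f x ∂ν := by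
  have hint : ∀ (ρ : Measure Ω) [IsFiniteMeasure ρ], Integrable f ρ := fun ρ _ =>
    f.continuous.integrable_of_hasCompactSupport (HasCompactSupport.of_compactSpace _)
  refine ext_inner_right ℝ fun y => ?_
  rw [inner_integral, hu, inner_sub_left, real_inner_comm y, real_inner_comm y,
    ← integral_inner (hint μ), ← integral_inner (hint ν)]
  congr 1 <;>
  · refine integral_congr_ae (Eventually.of_forall fun x => ?_)
    exact real_inner_comm _ _

/-! ### The operators `K`, `𝒦` and their preadjoint -/

/-- The control-to-observation operator `K u = ∫ k du`. -/
def opK {γ : ℝ≥0} (k : C1HolderKernel Ω Y γ) (u : Meas Ω) : Y := integral k.toMap u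

/-- The preadjoint `K_* y = (k(·), y)_Y`, as a bounded operator `Y → C¹(Ω)`; the gradient of
`K_* y` is `Dk(·)ᵀ y`. -/
def preK {γ : ℝ≥0} (k : C1HolderKernel Ω Y γ) : Y →L[ℝ] C1 Ω :=
  ((pairing k.toMap).prod (adjPairing k.deriv)).codRestrict (c1Submodule Ω) (by
    intro y x hx
    change HasGradientAt (zeroExt (fun z => inner ℝ (k.toMap z) y))
      (ContinuousLinearMap.adjoint (k.deriv x) y) x.1
    rw [zeroExt_map (fun w : Y => inner ℝ w y) (inner_zero_left y),
      hasGradientAt_iff_hasFDerivAt]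
    have h := (k.hasFDerivAt_interior x hx).inner ℝ (hasFDerivAt_const y x.1)
    refine h.congr_fderiv ?_
    ext v
    simp [ContinuousLinearMap.adjoint_inner_left, real_inner_comm])

/-- The lifted operator `𝒦 : C¹(Ω)* → Y`, `𝒦 [u, v] = ∫ k du + ∫ Dk dv`. The value does not depend
on the representing pair `(u, v)`, see `liftK_eqClass`. -/
def liftK {γ : ℝ≥0} (k : C1HolderKernel Ω Y γ) (h : C1Dual Ω) : Y :=
  integral k.toMap (exists_eqClass h).choose.1 + vecIntegral k.deriv (exists_eqClass h).choose.2

theorem inner_liftK {γ : ℝ≥0} (k : C1HolderKernel Ω Y γ) (h : C1Dual Ω) (y : Y) :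
    inner ℝ (liftK k h) y = h (preK k y) := by
  conv_rhs => rw [← (exists_eqClass h).choose_spec]
  rw [liftK, inner_add_left, inner_integral, inner_vecIntegral, eqClass_apply]
  rfl

theorem liftK_eqClass {γ : ℝ≥0} (k : C1HolderKernel Ω Y γ) (u : Meas Ω) (v : VecMeas Ω) :
    liftK k (eqClass u v) = integral k.toMap u + vecIntegral k.deriv v := by
  refine ext_inner_right ℝ fun y => ?_
  rw [inner_liftK, inner_add_left, inner_integral, inner_vecIntegral, eqClass_apply]
  rfl

/-! ### The objective and its lifted penalty term -/

/-- The objective functional `J(u) = L(K u) + α ‖u‖`. -/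
def objective {γ : ℝ≥0} (k : C1HolderKernel Ω Y γ) (L : Y → ℝ) (α : ℝ) (u : Meas Ω) : ℝ :=
  L (opK k u) + α * ‖u‖

open Classical in
/-- The lifted penalty term `G : C¹(Ω)* → [0, ∞]`: `G(Π u) = α ‖u‖`, and `G = ∞` off the range of
`Π`. -/
def liftG (α : ℝ) (h : C1Dual Ω) : EReal :=
  if hu : ∃ u : Meas Ω, inj u = h then ((α * ‖hu.choose‖ : ℝ) : EReal) else ⊤

/-- The dual variable `p = -K_* ∇L(K u) ∈ C¹(Ω)`. -/
def dualVar {γ : ℝ≥0} (k : C1HolderKernel Ω Y γ) (L : Y → ℝ) (u : Meas Ω) : C1 Ω :=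
  -preK k (gradient L (opK k u))

/-- The Hessian form `(w, ∇²L(y) w)_Y`. -/
def hessForm (L : Y → ℝ) (y w : Y) : ℝ := inner ℝ w (fderiv ℝ (gradient L) y w)

/-- The bounded Lipschitz norm: the supremum of `⟨φ, u⟩` over all `φ` with
`max (sup |φ|) (Lip φ) ≤ 1`. -/
def blNorm (u : Meas Ω) : ℝ :=
  sSup ((fun φ : C(Ω, ℝ) => u φ) '' {φ | ‖φ‖ ≤ 1 ∧ LipschitzWith 1 φ})

end Operators

/-! ### Weak* second subderivatives -/

section Subderivative

variable {Z : Type*} [NormedAddCommGroup Z] [NormedSpace ℝ Z]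

/-- Weak* convergence of a sequence in the dual space `Z*`. -/
def WeakStarTendsto (h : ℕ → StrongDual ℝ Z) (h₀ : StrongDual ℝ Z) : Prop :=
  ∀ z : Z, Tendsto (fun n => h n z) atTop (𝓝 (h₀ z))

/-- The weak* second subderivative `G''(x, p; h)` of `G : Z* → (-∞, ∞]` at `x` for `p ∈ Z`: the
infimum of `liminf (G(x + t_n h_n) - G(x) - t_n ⟨p, h_n⟩) / (t_n² / 2)` over all null sequences
`t_n > 0` and all `h_n` converging weakly* to `h`. -/
def weakStarSecondSubderiv (G : StrongDual ℝ Z → EReal) (x : StrongDual ℝ Z) (p : Z)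
    (h : StrongDual ℝ Z) : EReal :=
  sInf {r : EReal | ∃ (t : ℕ → ℝ) (g : ℕ → StrongDual ℝ Z),
    (∀ n, 0 < t n) ∧ Tendsto t atTop (𝓝 0) ∧ WeakStarTendsto g h ∧
    r = liminf (fun n =>
      (G (x + t n • g n) - G x - ((t n * g n p : ℝ) : EReal)) / ((t n ^ 2 / 2 : ℝ) : EReal))
      atTop}

end Subderivative

section Conditions

variable {d : ℕ} {Ω : TopologicalSpace.Compacts (Euc d)}
variable {Y : Type*} [NormedAddCommGroup Y] [InnerProductSpace ℝ Y] [CompleteSpace Y]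

/-- The lifted second-order condition
`(𝒦 h, ∇²L(K u) 𝒦 h)_Y + G''(Π u, p; h) > 0` for all `h ∈ C¹(Ω)* \ {0}`. -/
def SecondOrderCondition {γ : ℝ≥0} (k : C1HolderKernel Ω Y γ) (L : Y → ℝ) (α : ℝ)
    (u : Meas Ω) : Prop :=
  ∀ h : C1Dual Ω, h ≠ 0 →
    0 < ((hessForm L (opK k u) (liftK k h) : ℝ) : EReal) +
      weakStarSecondSubderiv (liftG α) (inj u) (dualVar k L u) h

/-- The non-degeneracy condition: for all `t_n > 0` tending to `0` and all `h_n` in the unit sphere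
of `C¹(Ω)*` converging weakly* to `0`,
`liminf ((G(Π u + t_n h_n) - G(Π u)) / t_n² - ⟨p, h_n⟩ / t_n) > 0`. -/
def NonDegeneracyCondition {γ : ℝ≥0} (k : C1HolderKernel Ω Y γ) (L : Y → ℝ) (α : ℝ)
    (u : Meas Ω) : Prop :=
  ∀ (t : ℕ → ℝ) (h : ℕ → C1Dual Ω), (∀ n, 0 < t n) → Tendsto t atTop (𝓝 0) →
    WeakStarTendsto h 0 → (∀ n, ‖h n‖ = 1) →
    0 < liminf (fun n =>
      ((1 / t n ^ 2 : ℝ) : EReal) * (liftG α (inj u + t n • h n) - liftG α (inj u)) -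
        ((1 / t n * h n (dualVar k L u) : ℝ) : EReal)) atTop

/-- Local quadratic growth of `J` around `u` with respect to the bounded Lipschitz norm. -/
def QuadraticGrowth {γ : ℝ≥0} (k : C1HolderKernel Ω Y γ) (L : Y → ℝ) (α : ℝ)
    (u : Meas Ω) : Prop :=
  ∃ c : ℝ, 0 < c ∧ ∃ ε : ℝ, 0 < ε ∧ ∀ w : Meas Ω, blNorm (w - u) ≤ ε →
    c * blNorm (w - u) ^ 2 ≤ objective k L α w - objective k L α u

end Conditions

end

end LiftedMeasures

namespace LiftedMeasures

noncomputable section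

/-! ### Completeness and separability of `C1 Ω`, embedding of measures, comparison of norms. -/

section Functions

variable {d : ℕ} {Ω : TopologicalSpace.Compacts (Euc d)}

/-! The whole question is moved to the dual space `C1Dual Ω`. The embedding `inj` is injective
(`inj_injective`), and quasiconvexity makes the bounded Lipschitz norm of `u` equivalent to `‖inj
u‖` (`blNorm_le_norm_inj`, `exists_norm_inj_le`), so quadratic growth may be read in the dual norm.

Write a competitor as `inj w = inj u + t • g`. Since the dual variable is `-K_* ∇L(K u)`, the linear
terms cancel, and the second-order quotient of `liftG` equals the quotient of the objective minus
the second-order quotient of `L` (`norm_difference_eq`). If `g` runs through a weak* convergent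
sequence, `liftK k g` converges in norm (`tendsto_liftK`), so the quotient of `L` tends to the
Hessian form (`tendsto_secondQuotient`). Only the quotient of the objective remains to be
controlled.

Growth bounds that quotient below by a multiple of `‖g‖ ^ 2`; weak* lower semicontinuity of the norm
gives the first condition, and `‖g‖ = 1` gives the second. Conversely, if growth fails, the
normalised differences of a violating sequence have a weak* convergent subsequence. A nonzero limit
contradicts the second-order condition; a zero limit, possible because the unit sphere is not weak*
closed in general, contradicts non-degeneracy. -/

theorem zeroExt_apply {F : Type*} [Zero F] (f : Ω → F) (x : Ω) : zeroExt f x.1 = f x :=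
  Subtype.val_injective.extend_apply _ _ _

theorem zeroExt_eventuallyEq {F : Type*} [Zero F] {f : Ω → F} {g : Euc d → F}
    (hfg : ∀ x : Ω, f x = g x.1) {x : Euc d} (hx : x ∈ interior (Ω : Set (Euc d))) :
    zeroExt f =ᶠ[𝓝 x] g := by
  filter_upwards [isOpen_interior.mem_nhds hx] with z hz
  exact (zeroExt_apply f ⟨z, interior_subset hz⟩).trans (hfg _)

/-- Uniform limits of functions and gradients remain a function and its gradient on the open
interior. The resulting completeness of `C1 Ω` is what the uniform boundedness principle for weak*
convergent sequences requires. -/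
theorem isClosed_c1Submodule :
    IsClosed (c1Submodule Ω : Set (C(Ω, ℝ) × C(Ω, Euc d))) := by
  refine isClosed_of_closure_subset fun p hp => ?_
  obtain ⟨q, hq, hqp⟩ := mem_closure_iff_seq_limit.1 hp
  intro x hx
  have h1 : Tendsto (fun n => (q n).1) atTop (𝓝 p.1) := (continuous_fst.tendsto p).comp hqp
  have h2 : Tendsto (fun n => (q n).2) atTop (𝓝 p.2) := (continuous_snd.tendsto p).comp hqp
  have key := hasFDerivAt_of_tendstoUniformlyOn (𝕜 := ℝ) (l := atTop)
    (f := fun n => zeroExt (q n).1) (g := zeroExt p.1)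
    (f' := fun n z => InnerProductSpace.toDual ℝ (Euc d) (zeroExt (q n).2 z))
    (g' := fun z => InnerProductSpace.toDual ℝ (Euc d) (zeroExt p.2 z))
    (isOpen_interior (s := (Ω : Set (Euc d)))) ?_ ?_ ?_ hx
  · simp only [zeroExt_apply] at key
    exact key
  · rw [Metric.tendstoUniformlyOn_iff]
    intro ε hε
    filter_upwards [Metric.tendsto_nhds.1 h2 ε hε] with n hn z hz
    rw [LinearIsometryEquiv.dist_map, zeroExt_apply p.2 ⟨z, interior_subset hz⟩,
      zeroExt_apply (q n).2 ⟨z, interior_subset hz⟩, dist_comm]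
    exact (ContinuousMap.dist_apply_le_dist _).trans_lt hn
  · intro n z hz
    have := hq n ⟨z, interior_subset hz⟩ hz
    rw [zeroExt_apply (q n).2 ⟨z, interior_subset hz⟩]
    exact this
  · intro z hz
    simp only [zeroExt_apply _ (⟨z, interior_subset hz⟩ : Ω)]
    exact ((continuous_eval_const _).tendsto p.1).comp h1

instance : CompleteSpace (C1 Ω) :=
  isClosed_c1Submodule.completeSpace_coe

instance : TopologicalSpace.SeparableSpace (C1 Ω) :=
  inferInstanceAs (TopologicalSpace.SeparableSpace (c1Submodule Ω))

theorem norm_C1_le {φ : C1 Ω} {M : ℝ} (hM : 0 ≤ M) (h1 : ∀ x, |φ.1.1 x| ≤ M)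
    (h2 : ∀ x, ‖φ.1.2 x‖ ≤ M) : ‖φ‖ ≤ M :=
  max_le ((ContinuousMap.norm_le _ hM).2 h1) ((ContinuousMap.norm_le _ hM).2 h2)

theorem abs_apply_le_norm (φ : C1 Ω) (x : Ω) : |φ.1.1 x| ≤ ‖φ‖ :=
  (φ.1.1.norm_coe_le_norm x).trans (le_max_left _ _)

theorem norm_grad_le_norm (φ : C1 Ω) (x : Ω) : ‖φ.1.2 x‖ ≤ ‖φ‖ :=
  (φ.1.2.norm_coe_le_norm x).trans (le_max_right _ _)

/-- The restriction to `Ω` of a continuously differentiable function on `ℝ^d`. -/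
def C1.ofContDiff (F : Euc d → ℝ) (hF : ContDiff ℝ 1 F) : C1 Ω :=
  ⟨(⟨fun x => F x.1, hF.continuous.comp continuous_subtype_val⟩,
    ⟨fun x => gradient F x.1, ((InnerProductSpace.toDual ℝ (Euc d)).symm.continuous.comp
      (hF.continuous_fderiv one_ne_zero)).comp continuous_subtype_val⟩), by
    intro x hx
    have h := ((hF.differentiable one_ne_zero) x.1).hasGradientAt
    exact h.congr_of_eventuallyEq (zeroExt_eventuallyEq (fun _ => rfl) hx)⟩

/-! ### Injectivity of the embedding of measures -/

variable (Ω) in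
/-- The algebra of restrictions to `Ω` of continuously differentiable functions on `ℝ^d`. -/
def contDiffSubalgebra : Subalgebra ℝ C(Ω, ℝ) where
  carrier := {f | ∃ F : Euc d → ℝ, ContDiff ℝ 1 F ∧ ∀ x : Ω, f x = F x.1}
  mul_mem' := by
    rintro f g ⟨F, hF, hf⟩ ⟨G, hG, hg⟩
    exact ⟨fun x => F x * G x, hF.mul hG, fun x => by simp [hf, hg]⟩
  add_mem' := by
    rintro f g ⟨F, hF, hf⟩ ⟨G, hG, hg⟩
    exact ⟨fun x => F x + G x, hF.add hG, fun x => by simp [hf, hg]⟩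
  algebraMap_mem' r := ⟨fun _ => r, contDiff_const, fun _ => rfl⟩

/-- Stone–Weierstrass; the coordinate functions separate points. -/
theorem dense_contDiffSubalgebra : (contDiffSubalgebra Ω).topologicalClosure = ⊤ := by
  refine ContinuousMap.subalgebra_topologicalClosure_eq_top_of_separatesPoints _ ?_
  intro x y hxy
  obtain ⟨i, hi⟩ : ∃ i, x.1 i ≠ y.1 i := by
    by_contra! h
    exact hxy (Subtype.ext (PiLp.ext h))
  have hF : ContDiff ℝ 1 (fun z : Euc d => z i) := by fun_prop
  exact ⟨fun z => z.1 i,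
    ⟨⟨fun z => z.1 i, hF.continuous.comp continuous_subtype_val⟩, ⟨_, hF, fun _ => rfl⟩, rfl⟩, hi⟩

theorem inj_apply (u : Meas Ω) (φ : C1 Ω) : inj u φ = u φ.1.1 := by
  simp [inj, eqClass_apply]

/-- A measure is determined by its values on a dense set of smooth functions. This also makes the
chosen preimage in `liftG` unambiguous. -/
theorem inj_injective : Function.Injective (inj : Meas Ω → C1Dual Ω) := by
  intro u v huv
  ext f
  have hf : f ∈ closure (contDiffSubalgebra Ω : Set C(Ω, ℝ)) := by
    have : f ∈ (contDiffSubalgebra Ω).topologicalClosure := by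
      rw [dense_contDiffSubalgebra]; trivial
    exact this
  refine (isClosed_eq u.continuous v.continuous).closure_subset_iff.2 ?_ hf
  rintro g ⟨F, hF, hg⟩
  have h := DFunLike.congr_fun huv (C1.ofContDiff F hF)
  rw [inj_apply, inj_apply] at h
  have : g = (C1.ofContDiff (Ω := Ω) F hF).1.1 := ContinuousMap.ext hg
  rw [Set.mem_ofPred_eq, this, h]

theorem inj_sub (u v : Meas Ω) : inj (u - v) = inj u - inj v := by
  ext φ; simp [inj_apply]

theorem liftG_inj (α : ℝ) (u : Meas Ω) : liftG α (inj u) = ((α * ‖u‖ : ℝ) : EReal) := by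
  have hu : ∃ w : Meas Ω, inj w = inj u := ⟨u, rfl⟩
  rw [liftG, dif_pos hu, inj_injective hu.choose_spec]

theorem liftG_eq_top (α : ℝ) {h : C1Dual Ω} (hh : ¬ ∃ u : Meas Ω, inj u = h) :
    liftG α h = ⊤ := dif_neg hh

/-! ### Comparison of the bounded Lipschitz norm with the norm of `C¹(Ω)*` -/

theorem bddAbove_blNorm (u : Meas Ω) : BddAbove
    ((fun φ : C(Ω, ℝ) => u φ) '' {φ | ‖φ‖ ≤ 1 ∧ LipschitzWith 1 φ}) := by
  refine ⟨‖u‖, ?_⟩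
  rintro _ ⟨φ, ⟨hφ, -⟩, rfl⟩
  exact (le_abs_self _).trans (u.unit_le_opNorm φ hφ)

theorem le_blNorm (u : Meas Ω) {φ : C(Ω, ℝ)} (h1 : ‖φ‖ ≤ 1) (h2 : LipschitzWith 1 φ) :
    u φ ≤ blNorm u :=
  le_csSup (bddAbove_blNorm u) ⟨φ, ⟨h1, h2⟩, rfl⟩

theorem blNorm_nonneg (u : Meas Ω) : 0 ≤ blNorm u := by
  have := le_blNorm u (φ := 0) (by simp) (LipschitzWith.const' 0)
  simpa using this

/-- Mollification of a Lipschitz function. -/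
theorem exists_contDiff_lipschitz_approx {F : Euc d → ℝ} (hF : LipschitzWith 1 F) {ε : ℝ}
    (hε : 0 < ε) : ∃ G : Euc d → ℝ, ContDiff ℝ 1 G ∧ LipschitzWith 1 G ∧
      ∀ x, |G x - F x| ≤ ε := by
  let b : ContDiffBump (0 : Euc d) := ⟨ε / 2, ε, by positivity, by linarith⟩
  have hloc : LocallyIntegrable F volume := hF.continuous.locallyIntegrable
  have hconv : ConvolutionExists (b.normed volume) F (ContinuousLinearMap.lsmul ℝ ℝ) volume :=
    (b.hasCompactSupport_normed (μ := volume)).convolutionExists_left _ b.continuous_normed hloc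
  refine ⟨convolution (b.normed volume) F (ContinuousLinearMap.lsmul ℝ ℝ) volume, ?_, ?_, ?_⟩
  · have h : ContDiff ℝ ((1 : ℕ∞) : WithTop ℕ∞) (b.normed volume) := b.contDiff_normed
    exact b.hasCompactSupport_normed.contDiff_convolution_left _ h hloc
  · refine LipschitzWith.of_dist_le_mul fun x y => ?_
    rw [dist_eq_norm, convolution, convolution, ← integral_sub (hconv x) (hconv y)]
    have hint : Integrable (fun t => b.normed volume t * dist x y) volume :=
      b.integrable_normed.mul_const _
    refine (norm_integral_le_of_norm_le hint (Eventually.of_forall fun t => ?_)).trans_eq ?_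
    · simp only [ContinuousLinearMap.lsmul_apply, smul_eq_mul]
      rw [← mul_sub, norm_mul, Real.norm_of_nonneg (b.nonneg_normed t)]
      gcongr
      · exact b.nonneg_normed t
      · have := hF.dist_le_mul (x - t) (y - t)
        simpa [Real.dist_eq] using this
    · rw [integral_mul_const, b.integral_normed]; simp
  · intro x
    rw [← Real.dist_eq]
    refine b.dist_normed_convolution_le hF.continuous.aestronglyMeasurable fun z hz => ?_
    refine (hF.dist_le_mul z x).trans ?_
    simpa using (Metric.mem_ball.1 hz).le

/-- A Lipschitz test function on `Ω` is extended to all of space and mollified, which yields an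
element of `C1 Ω` of norm at most `1 + ε` within `ε` of it. The geometry of `Ω` plays no role in
this direction. -/
theorem blNorm_le_norm_inj (u : Meas Ω) : blNorm u ≤ ‖inj u‖ := by
  refine csSup_le ⟨u 0, 0, ⟨by simp, LipschitzWith.const' 0⟩, rfl⟩ ?_
  rintro _ ⟨φ, ⟨hφ1, hφ2⟩, rfl⟩
  have hφext : LipschitzOnWith 1 (zeroExt φ) (Ω : Set (Euc d)) := by
    refine LipschitzOnWith.of_dist_le_mul fun x hx y hy => ?_
    rw [zeroExt_apply φ ⟨x, hx⟩, zeroExt_apply φ ⟨y, hy⟩]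
    exact hφ2.dist_le_mul _ _
  obtain ⟨F, hF, hFeq⟩ := hφext.extend_real
  have hbound : ∀ ε : ℝ, 0 < ε → u φ ≤ ‖inj u‖ + ε * (‖inj u‖ + ‖u‖) := by
    intro ε hε
    obtain ⟨G, hG1, hG2, hG3⟩ := exists_contDiff_lipschitz_approx hF hε
    let ψ : C1 Ω := C1.ofContDiff G hG1
    have hclose : ∀ x, |φ x - ψ.1.1 x| ≤ ε := fun x => by
      rw [abs_sub_comm, ← zeroExt_apply φ x, hFeq x.2]
      exact hG3 x.1
    have hψ : ‖ψ‖ ≤ 1 + ε := by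
      refine norm_C1_le (by positivity) (fun x => ?_) fun x => ?_
      · have h1 := hclose x
        have h2 := (φ.norm_coe_le_norm x).trans hφ1
        rw [Real.norm_eq_abs] at h2
        rw [abs_le] at *
        constructor <;> linarith
      · have : ‖gradient G x.1‖ ≤ 1 := by
          rw [gradient, LinearIsometryEquiv.norm_map]
          simpa using norm_fderiv_le_of_lipschitz ℝ hG2 (x₀ := x.1)
        exact this.trans (by linarith)
    have h1 : u (φ - ψ.1.1) ≤ ‖u‖ * ε :=
      (le_abs_self _).trans (u.le_opNorm_of_le ((ContinuousMap.norm_le _ hε.le).2 hclose))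
    have h2 : u ψ.1.1 ≤ ‖inj u‖ * (1 + ε) := by
      rw [← inj_apply]
      exact (le_abs_self _).trans ((inj u).le_opNorm_of_le hψ)
    rw [map_sub] at h1
    linarith
  -- The total variation `‖u‖` enters only through the mollification error and disappears as `ε`
  -- tends to `0`.
  have hlim : Tendsto (fun ε : ℝ => ‖inj u‖ + ε * (‖inj u‖ + ‖u‖)) (𝓝[>] 0) (𝓝 ‖inj u‖) := by
    have : Continuous (fun ε : ℝ => ‖inj u‖ + ε * (‖inj u‖ + ‖u‖)) := by fun_prop
    simpa using (this.tendsto 0).mono_left nhdsWithin_le_nhds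
  exact ge_of_tendsto hlim (eventually_nhdsWithin_of_forall hbound)

/-- Along a curve in the interior, a function of class `C¹` is Lipschitz. -/
theorem abs_sub_le_of_curve {φ : C1 Ω} {K : ℝ≥0} {c : ℝ → Euc d}
    (hc : ∀ s ∈ Set.Icc (0 : ℝ) 1, c s ∈ interior (Ω : Set (Euc d)))
    (hcL : LipschitzOnWith K c (Set.Icc (0 : ℝ) 1)) :
    zeroExt φ.1.1 (c 1) - zeroExt φ.1.1 (c 0) ≤ ‖φ‖ * K := by
  set f : ℝ → ℝ := fun s => zeroExt φ.1.1 (c s) - zeroExt φ.1.1 (c 0) with hf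
  have hderiv : ∀ z ∈ interior (Ω : Set (Euc d)), ∃ p : Euc d, ‖p‖ ≤ ‖φ‖ ∧
      HasGradientAt (zeroExt φ.1.1) p z := fun z hz =>
    ⟨_, norm_grad_le_norm φ ⟨z, interior_subset hz⟩, φ.2 ⟨z, interior_subset hz⟩ hz⟩
  have hcont : ContinuousOn f (Set.Icc 0 1) := by
    refine ContinuousOn.sub (fun s hs => ?_) continuousOn_const
    obtain ⟨p, -, hp⟩ := hderiv _ (hc s hs)
    exact hp.hasFDerivAt.continuousAt.comp_continuousWithinAt (hcL.continuousOn s hs)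
  -- The curve is only Lipschitz, so `f` need not be differentiable. It is compared with the line of
  -- slope `‖φ‖ * K` through its right-hand difference quotients, which the mean value inequality on
  -- a small convex ball controls.
  have key := image_le_of_liminf_slope_right_le_deriv_boundary (f := f) (a := 0) (b := 1)
    (B := fun s => ‖φ‖ * K * s) (B' := fun _ => ‖φ‖ * K) hcont (by simp [hf]) (by fun_prop)
    (fun x _ => by simpa using ((hasDerivAt_id x).const_mul (‖φ‖ * K)).hasDerivWithinAt) ?_
    (Set.right_mem_Icc.2 zero_le_one)
  · simpa [hf] using key
  intro s hs r hr
  obtain ⟨δ, hδ, hball⟩ := Metric.isOpen_iff.1 isOpen_interior _ (hc s (Set.Ico_subset_Icc_self hs))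
  have hφball : ∀ z ∈ Metric.ball (c s) δ,
      zeroExt φ.1.1 z - zeroExt φ.1.1 (c s) ≤ ‖φ‖ * ‖z - c s‖ := fun z hz => by
    refine (le_abs_self _).trans ?_
    refine (convex_ball (c s) δ).norm_image_sub_le_of_norm_hasFDerivWithin_le (𝕜 := ℝ)
      (f' := fun w => fderiv ℝ (zeroExt φ.1.1) w) (fun w hw => ?_) (fun w hw => ?_)
      (Metric.mem_ball_self hδ) hz
    · obtain ⟨p, -, hp⟩ := hderiv _ (hball hw)
      exact hp.differentiableAt.hasFDerivAt.hasFDerivWithinAt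
    · obtain ⟨p, hp1, hp⟩ := hderiv _ (hball hw)
      rw [hp.hasFDerivAt.fderiv, LinearIsometryEquiv.norm_map]
      exact hp1
  have hcs : ContinuousWithinAt c (Set.Ioi s) s :=
    ((hcL.continuousOn s (Set.Ico_subset_Icc_self hs)).mono_of_mem_nhdsWithin
      (Icc_mem_nhdsGT_of_mem hs))
  have hev : ∀ᶠ z in 𝓝[>] s, slope f s z < r := by
    filter_upwards [hcs (Metric.ball_mem_nhds _ hδ), Icc_mem_nhdsGT_of_mem hs,
      self_mem_nhdsWithin] with z hz1 hz2 hz3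
    have hpos : 0 < z - s := sub_pos.2 hz3
    rw [slope_def_field, div_lt_iff₀ hpos]
    have h1 := hφball _ hz1
    have h2 := hcL.dist_le_mul _ hz2 _ (Set.Ico_subset_Icc_self hs)
    rw [dist_eq_norm, Real.dist_eq, abs_of_pos hpos] at h2
    calc f z - f s = zeroExt φ.1.1 (c z) - zeroExt φ.1.1 (c s) := by simp [hf]
      _ ≤ ‖φ‖ * (K * (z - s)) := h1.trans (by gcongr)
      _ = ‖φ‖ * K * (z - s) := by ring
      _ < r * (z - s) := by gcongr
  exact hev.frequently

/-- Interior points at distance at most `r` are joined by a curve, giving the constant `C`; for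
farther points the oscillation bound `2 * ‖φ‖` is at most `2 / r * ‖φ‖ * dist x y`. Density of the
interior extends the estimate to `Ω`. -/
theorem exists_lipschitz_const (hΩ : closure (interior (Ω : Set (Euc d))) = Ω)
    (hΩq : UniformlyLocallyQuasiconvex (interior (Ω : Set (Euc d)))) :
    ∃ M : ℝ, 1 ≤ M ∧ ∀ (φ : C1 Ω) (x y : Ω), |φ.1.1 x - φ.1.1 y| ≤ M * ‖φ‖ * dist x y := by
  obtain ⟨r, hr, C, hC, hcurve⟩ := hΩq
  refine ⟨max C (2 / r), le_max_of_le_left (by exact_mod_cast hC), fun φ => ?_⟩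
  have hint : ∀ x y : Ω, x.1 ∈ interior (Ω : Set (Euc d)) → y.1 ∈ interior (Ω : Set (Euc d)) →
      φ.1.1 x - φ.1.1 y ≤ max (C : ℝ) (2 / r) * ‖φ‖ * dist x y := by
    intro x y hx hy
    rcases le_or_gt (dist x.1 y.1) r with hle | hgt
    · obtain ⟨c, hc0, hc1, hcm, hcL⟩ := hcurve _ hy _ hx hle
      have := abs_sub_le_of_curve (φ := φ) hcm hcL
      rw [hc0, hc1, zeroExt_apply, zeroExt_apply] at this
      refine this.trans ?_
      push_cast
      calc ‖φ‖ * (C * dist x.1 y.1) = C * ‖φ‖ * dist x.1 y.1 := by ring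
        _ ≤ _ := by gcongr; exacts [le_max_left _ _, le_rfl]
    · have h1 := abs_apply_le_norm φ x
      have h2 := abs_apply_le_norm φ y
      rw [abs_le] at h1 h2
      have h3 : 2 ≤ max (C : ℝ) (2 / r) * dist x y := by
        calc (2 : ℝ) = 2 / r * r := by field_simp
          _ ≤ _ := by gcongr; exacts [le_max_right _ _, hgt.le]
      have := mul_le_mul_of_nonneg_left h3 (norm_nonneg φ)
      nlinarith
  have hdense : Dense {x : Ω | x.1 ∈ interior (Ω : Set (Euc d))} := by
    intro x
    rw [closure_subtype]
    have hx : x.1 ∈ closure (interior (Ω : Set (Euc d))) := by rw [hΩ]; exact x.2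
    refine closure_mono (fun z hz => ?_) hx
    exact ⟨⟨z, interior_subset hz⟩, hz, rfl⟩
  have hall : ∀ p : Ω × Ω,
      φ.1.1 p.1 - φ.1.1 p.2 ≤ max (C : ℝ) (2 / r) * ‖φ‖ * dist p.1 p.2 := by
    have hclosed : IsClosed {p : Ω × Ω |
        φ.1.1 p.1 - φ.1.1 p.2 ≤ max (C : ℝ) (2 / r) * ‖φ‖ * dist p.1 p.2} :=
      isClosed_le (by fun_prop) (by fun_prop)
    intro p
    exact hclosed.closure_subset_iff.2 (fun q hq => hint q.1 q.2 hq.1 hq.2)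
      ((hdense.prod hdense) p)
  intro x y
  rw [abs_le]
  constructor
  · have := hall (y, x)
    rw [dist_comm] at this
    linarith
  · exact hall (x, y)

theorem exists_norm_inj_le (hΩ : closure (interior (Ω : Set (Euc d))) = Ω)
    (hΩq : UniformlyLocallyQuasiconvex (interior (Ω : Set (Euc d)))) :
    ∃ M : ℝ, 1 ≤ M ∧ ∀ u : Meas Ω, ‖inj u‖ ≤ M * blNorm u := by
  obtain ⟨M, hM, hLip⟩ := exists_lipschitz_const hΩ hΩq
  have hM0 : 0 < M := by linarith
  refine ⟨M, hM, fun u => ?_⟩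
  have hle : ∀ φ : C1 Ω, inj u φ ≤ M * blNorm u * ‖φ‖ := by
    intro φ
    rcases eq_or_ne φ 0 with rfl | hφ
    · simp
    have hφ0 : 0 < ‖φ‖ := norm_pos_iff.2 hφ
    have hs : 0 < M * ‖φ‖ := by positivity
    -- This rescaling is admissible for `blNorm`: the Lipschitz bound is that of `hLip`, and the sup
    -- bound uses `1 ≤ M`.
    have h := le_blNorm u (φ := (M * ‖φ‖)⁻¹ • φ.1.1) ?_ ?_
    · rw [map_smul, smul_eq_mul, inv_mul_le_iff₀ hs] at h
      rw [inj_apply]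
      linarith
    · refine (ContinuousMap.norm_le _ zero_le_one).2 fun x => ?_
      rw [ContinuousMap.smul_apply, smul_eq_mul, norm_mul, norm_inv, Real.norm_of_nonneg hs.le,
        inv_mul_le_iff₀ hs]
      have := abs_apply_le_norm φ x
      rw [Real.norm_eq_abs]
      nlinarith
    · refine LipschitzWith.of_dist_le_mul fun x y => ?_
      rw [ContinuousMap.smul_apply, ContinuousMap.smul_apply, dist_smul₀, norm_inv,
        Real.norm_of_nonneg hs.le, inv_mul_le_iff₀ hs, Real.dist_eq]
      simpa using hLip φ x y
  refine ContinuousLinearMap.opNorm_le_bound _ (mul_nonneg hM0.le (blNorm_nonneg u)) fun φ => ?_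
  rw [Real.norm_eq_abs, abs_le]
  have h1 := hle φ
  have h2 := hle (-φ)
  rw [map_neg, norm_neg] at h2
  constructor <;> linarith

end Functions

end

end LiftedMeasures

namespace LiftedMeasures

noncomputable section

/-! ### Weak* convergence in dual spaces. -/

section Abstract

variable {E : Type*} [NormedAddCommGroup E] [NormedSpace ℝ E]

/-- Bounded functionals that converge to zero pointwise converge uniformly on compact sets. -/
theorem eventually_abs_lt_of_isCompact {e : ℕ → StrongDual ℝ E} {M : ℝ} (hM : ∀ n, ‖e n‖ ≤ M)
    (he : WeakStarTendsto e 0) {S : Set E} (hS : IsCompact S) {ε : ℝ} (hε : 0 < ε) :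
    ∀ᶠ n in atTop, ∀ s ∈ S, |e n s| < ε := by
  have hM0 : 0 ≤ M := (norm_nonneg _).trans (hM 0)
  -- On a finite net of this mesh pointwise convergence is uniform, and moving to the nearest net
  -- point costs less than `ε / 2`.
  obtain ⟨T, hTfin, hT⟩ := Metric.totallyBounded_iff.1 hS.totallyBounded (ε / (2 * (M + 1)))
    (by positivity)
  have hev : ∀ᶠ n in atTop, ∀ z ∈ T, |e n z| < ε / 2 := by
    refine (eventually_all_finite hTfin).2 fun z _ => ?_
    have := Metric.tendsto_nhds.1 (he z) (ε / 2) (by positivity)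
    simpa [Real.dist_eq] using this
  filter_upwards [hev] with n hn s hs
  obtain ⟨z, hz, hsz⟩ := Set.mem_iUnion₂.1 (hT hs)
  have h1 : |e n (s - z)| ≤ M * (ε / (2 * (M + 1))) :=
    (e n).le_of_opNorm_le_of_le (hM n) (by rw [← dist_eq_norm]; exact (Metric.mem_ball.1 hsz).le)
  have h2 : M * (ε / (2 * (M + 1))) < ε / 2 := by
    rw [mul_div_assoc', div_lt_div_iff₀ (by positivity) (by positivity)]
    nlinarith
  have h3 : e n s = e n (s - z) + e n z := by rw [← map_add, sub_add_cancel]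
  rw [h3]
  exact (abs_add_le _ _).trans_lt (by linarith [hn z hz])

theorem WeakStarTendsto.exists_norm_le [CompleteSpace E] {e : ℕ → StrongDual ℝ E}
    {e₀ : StrongDual ℝ E} (he : WeakStarTendsto e e₀) : ∃ M : ℝ, ∀ n, ‖e n‖ ≤ M := by
  refine banach_steinhaus fun z => ?_
  obtain ⟨C, hC⟩ := (he z).norm.bddAbove_range
  exact ⟨C, fun n => hC ⟨n, rfl⟩⟩

/-- Weak* lower semicontinuity of the dual norm. -/
theorem WeakStarTendsto.eventually_lt_norm {e : ℕ → StrongDual ℝ E} {e₀ : StrongDual ℝ E}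
    (he : WeakStarTendsto e e₀) {m : ℝ} (hm : m < ‖e₀‖) : ∀ᶠ n in atTop, m < ‖e n‖ := by
  rcases lt_or_ge m 0 with hm0 | hm0
  · exact Eventually.of_forall fun n => hm0.trans_le (norm_nonneg _)
  obtain ⟨z, hz⟩ : ∃ z, m * ‖z‖ < ‖e₀ z‖ := by
    by_contra! h
    exact hm.not_ge (e₀.opNorm_le_bound hm0 h)
  filter_upwards [(he z).norm.eventually (lt_mem_nhds hz)] with n hn
  by_contra! h
  exact hn.not_ge ((e n).le_of_opNorm_le h z)

/-- Sequential Banach–Alaoglu. -/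
theorem exists_weakStar_subseq [TopologicalSpace.SeparableSpace E] {e : ℕ → StrongDual ℝ E}
    (he : ∀ n, ‖e n‖ = 1) : ∃ (e₀ : StrongDual ℝ E) (ν : ℕ → ℕ), StrictMono ν ∧
      WeakStarTendsto (e ∘ ν) e₀ := by
  obtain ⟨e₀, -, ν, hν, hlim⟩ := WeakDual.isSeqCompact_closedBall ℝ E (0 : StrongDual ℝ E) 1
    (x := fun n => StrongDual.toWeakDual (e n)) (fun n => by simp [he n])
  refine ⟨WeakDual.toStrongDual e₀, ν, hν, fun z => ?_⟩
  exact ((WeakDual.eval_continuous z).tendsto e₀).comp hlim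

theorem weakStarSecondSubderiv_le (G : StrongDual ℝ E → EReal) (x : StrongDual ℝ E) (p : E)
    {h : StrongDual ℝ E} {t : ℕ → ℝ} {g : ℕ → StrongDual ℝ E} (ht : ∀ n, 0 < t n)
    (ht0 : Tendsto t atTop (𝓝 0)) (hg : WeakStarTendsto g h) :
    weakStarSecondSubderiv G x p h ≤ liminf (fun n =>
      (G (x + t n • g n) - G x - ((t n * g n p : ℝ) : EReal)) / ((t n ^ 2 / 2 : ℝ) : EReal))
      atTop :=
  sInf_le ⟨t, g, ht, ht0, hg, rfl⟩

end Abstract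

/-! ### Second-order expansion of the smooth part. -/

section Taylor

variable {Y : Type*} [NormedAddCommGroup Y] [InnerProductSpace ℝ Y] [CompleteSpace Y]

theorem hasGradientAt_gradient {L : Y → ℝ} (hL : ContDiff ℝ 2 L) (y : Y) :
    HasGradientAt L (gradient L y) y :=
  (hL.differentiable two_ne_zero y).hasGradientAt

theorem differentiable_gradient {L : Y → ℝ} (hL : ContDiff ℝ 2 L) :
    Differentiable ℝ (gradient L) := by
  have h : ContDiff ℝ 1 (fderiv ℝ L) := hL.fderiv_right (by norm_num)
  exact ((InnerProductSpace.toDual ℝ Y).symm.toContinuousLinearEquiv.differentiable).comp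
    (h.differentiable one_ne_zero)

/-- Second-order Taylor expansion along a ray. -/
theorem exists_taylor_bound {L : Y → ℝ} (hL : ContDiff ℝ 2 L) (y : Y) {ε : ℝ} (hε : 0 < ε) :
    ∃ δ > 0, ∀ w : Y, ‖w‖ < δ →
      |L (y + w) - L y - inner ℝ (gradient L y) w - hessForm L y w / 2| ≤ ε * ‖w‖ ^ 2 := by
  have hd := (differentiable_gradient hL y).hasFDerivAt
  rw [hasFDerivAt_iff_isLittleO_nhds_zero] at hd
  obtain ⟨δ, hδ, hball⟩ := Metric.eventually_nhds_iff_ball.1 (hd.def hε)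
  refine ⟨δ, hδ, fun w hw => ?_⟩
  have hderiv : ∀ s ∈ Set.Icc (0 : ℝ) 1, HasDerivWithinAt
      (fun s : ℝ => L (y + s • w) - s * inner ℝ (gradient L y) w - s ^ 2 * (hessForm L y w / 2))
      (inner ℝ (gradient L (y + s • w)) w - inner ℝ (gradient L y) w - s * hessForm L y w)
      (Set.Icc 0 1) s := by
    intro s _
    have h1 : HasDerivAt (fun s : ℝ => y + s • w) w s := by
      simpa using ((hasDerivAt_id s).smul_const w).const_add y
    have h2 := (hasGradientAt_gradient hL (y + s • w)).hasFDerivAt.comp_hasDerivAt s h1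
    have h3 := (hasDerivAt_id s).mul_const (inner ℝ (gradient L y) w)
    have h4 := ((hasDerivAt_id s).pow 2).mul_const (hessForm L y w / 2)
    refine (((h2.sub h3).sub h4).congr_deriv ?_).hasDerivWithinAt
    simp
    ring
  -- The derivative in `s` is the remainder of the linearisation of `gradient L` at `y`, paired with
  -- `w`; differentiability of the gradient at the single point `y` bounds it by `ε * ‖w‖ ^ 2`.
  have key := (convex_Icc (0 : ℝ) 1).norm_image_sub_le_of_norm_hasDerivWithin_le hderiv
    (C := ε * ‖w‖ ^ 2) (fun s hs => ?_) (Set.left_mem_Icc.2 zero_le_one)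
    (Set.right_mem_Icc.2 zero_le_one)
  · refine Eq.trans_le ?_ (key.trans_eq (by simp))
    rw [Real.norm_eq_abs]
    congr 1
    simp
    ring
  · have hsw : ‖s • w‖ ≤ ‖w‖ := by
      rw [norm_smul, Real.norm_of_nonneg hs.1]
      exact mul_le_of_le_one_left (norm_nonneg _) hs.2
    have hb := hball (s • w) (by simpa using hsw.trans_lt hw)
    have heq : inner ℝ (gradient L (y + s • w)) w - inner ℝ (gradient L y) w - s * hessForm L y w
        = inner ℝ (gradient L (y + s • w) - gradient L y - fderiv ℝ (gradient L) y (s • w)) w := by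
      rw [hessForm, inner_sub_left, inner_sub_left, map_smul, real_inner_smul_left,
        real_inner_comm w (fderiv ℝ (gradient L) y w)]
    rw [heq]
    refine (norm_inner_le_norm _ _).trans ?_
    calc _ ≤ ε * ‖w‖ * ‖w‖ := by gcongr; exact hb.trans (by gcongr)
      _ = ε * ‖w‖ ^ 2 := by ring

/-- The second-order difference quotient of the smooth part `L`. -/
def secondQuotient (L : Y → ℝ) (y : Y) (t : ℝ) (w : Y) : ℝ :=
  (L (y + t • w) - L y - t * inner ℝ (gradient L y) w) / (t ^ 2 / 2)

theorem tendsto_secondQuotient {L : Y → ℝ} (hL : ContDiff ℝ 2 L) (y : Y) {t : ℕ → ℝ}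
    (ht : ∀ n, 0 < t n) (ht0 : Tendsto t atTop (𝓝 0)) {w : ℕ → Y} {w₀ : Y}
    (hw : Tendsto w atTop (𝓝 w₀)) :
    Tendsto (fun n => secondQuotient L y (t n) (w n)) atTop (𝓝 (hessForm L y w₀)) := by
  have hhess : Tendsto (fun n => hessForm L y (w n)) atTop (𝓝 (hessForm L y w₀)) := by
    have : Continuous (hessForm L y) := by unfold hessForm; fun_prop
    exact (this.tendsto w₀).comp hw
  refine tendsto_of_tendsto_of_dist hhess ?_
  obtain ⟨M, hM⟩ := hw.norm.bddAbove_range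
  have hM' : ∀ n, ‖w n‖ ≤ M := fun n => hM ⟨n, rfl⟩
  have hM0 : 0 ≤ M := (norm_nonneg _).trans (hM' 0)
  have htw : Tendsto (fun n => ‖t n • w n‖) atTop (𝓝 0) := by
    simpa using (ht0.smul hw).norm
  rw [Metric.tendsto_nhds]
  intro ε hε
  obtain ⟨δ, hδ, hT⟩ := exists_taylor_bound hL y (ε := ε / (4 * (M ^ 2 + 1))) (by positivity)
  filter_upwards [htw.eventually (gt_mem_nhds hδ)] with n hn
  have h := hT _ hn
  have ht2 : 0 < t n ^ 2 / 2 := by have := ht n; positivity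
  have hq : hessForm L y (t n • w n) = t n ^ 2 * hessForm L y (w n) := by
    simp [hessForm, inner_smul_left, inner_smul_right]
    ring
  rw [hq, inner_smul_right, norm_smul, Real.norm_of_nonneg (ht n).le] at h
  rw [dist_zero_right, Real.norm_of_nonneg dist_nonneg, dist_comm, Real.dist_eq, secondQuotient,
    div_sub' ht2.ne', abs_div, abs_of_pos ht2, div_lt_iff₀ ht2]
  calc _ = |L (y + t n • w n) - L y - t n * inner ℝ (gradient L y) (w n)
        - t n ^ 2 * hessForm L y (w n) / 2| := by congr 1; ring
    _ ≤ ε / (4 * (M ^ 2 + 1)) * (t n * ‖w n‖) ^ 2 := h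
    _ ≤ ε / (4 * (M ^ 2 + 1)) * (t n * M) ^ 2 := by have := (ht n).le; have := hM' n; gcongr
    _ = ε * (M ^ 2 / (2 * (M ^ 2 + 1))) * (t n ^ 2 / 2) := by field_simp; ring
    _ < ε * (t n ^ 2 / 2) := by
      gcongr
      apply mul_lt_of_lt_one_right hε
      rw [div_lt_one (by positivity)]
      nlinarith

end Taylor

/-! ### Compactness of the lifted operator. -/

section Compactness

variable {d : ℕ} {Ω : TopologicalSpace.Compacts (Euc d)}
variable {Y : Type*} [NormedAddCommGroup Y] [InnerProductSpace ℝ Y] [CompleteSpace Y]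

theorem liftK_inj {γ : ℝ≥0} (k : C1HolderKernel Ω Y γ) (u : Meas Ω) :
    liftK k (inj u) = opK k u := by
  refine ext_inner_right ℝ fun y => ?_
  rw [inner_liftK, inj, eqClass_apply, opK, inner_integral]
  simp
  rfl

theorem liftK_add {γ : ℝ≥0} (k : C1HolderKernel Ω Y γ) (g h : C1Dual Ω) :
    liftK k (g + h) = liftK k g + liftK k h := by
  refine ext_inner_right ℝ fun y => ?_
  simp [inner_add_left, inner_liftK]

theorem liftK_smul {γ : ℝ≥0} (k : C1HolderKernel Ω Y γ) (c : ℝ) (h : C1Dual Ω) :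
    liftK k (c • h) = c • liftK k h := by
  refine ext_inner_right ℝ fun y => ?_
  simp [inner_smul_left, inner_liftK]

theorem norm_liftK_le {γ : ℝ≥0} (k : C1HolderKernel Ω Y γ) (h : C1Dual Ω) :
    ‖liftK k h‖ ≤ ‖h‖ * ‖preK k‖ := by
  rcases eq_or_ne (liftK k h) 0 with h0 | h0
  · rw [h0, norm_zero]; positivity
  have h1 : ‖liftK k h‖ * ‖liftK k h‖ ≤ ‖h‖ * (‖preK k‖ * ‖liftK k h‖) := by
    rw [← real_inner_self_eq_norm_mul_norm, inner_liftK]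
    exact (le_abs_self _).trans (h.le_opNorm_of_le ((preK k).le_opNorm _))
  rw [← mul_assoc] at h1
  exact le_of_mul_le_mul_right h1 (norm_pos_iff.2 h0)

/-- The operator `K_*` maps weakly null sequences to norm null sequences. -/
theorem eventually_norm_preK_le {γ : ℝ≥0} (k : C1HolderKernel Ω Y γ) {y : ℕ → Y} {M : ℝ}
    (hM : ∀ n, ‖y n‖ ≤ M) (hy : ∀ z, Tendsto (fun n => inner ℝ (y n) z) atTop (𝓝 0))
    {ε : ℝ} (hε : 0 < ε) : ∀ᶠ n in atTop, ‖preK k (y n)‖ ≤ ε := by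
  have he : WeakStarTendsto (fun n => InnerProductSpace.toDual ℝ Y (y n)) 0 := fun z => by
    simpa using hy z
  have hb : ∀ n, ‖InnerProductSpace.toDual ℝ Y (y n)‖ ≤ M := fun n => by simpa using hM n
  have hS₁ : IsCompact (Set.range k.toMap) := isCompact_range k.toMap.continuous
  -- The two compact sets hold all `k(x)` and all `Dk(x) v` with `|v| ≤ 1`; uniform smallness on
  -- them is smallness of `preK k (y n)` and of its gradient.
  have hS₂ : IsCompact ((fun p : (Euc d →L[ℝ] Y) × Euc d => p.1 p.2) ''
      (Set.range k.deriv ×ˢ Metric.closedBall 0 1)) :=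
    ((isCompact_range k.deriv.continuous).prod (isCompact_closedBall _ _)).image
      isBoundedBilinearMap_apply.continuous
  filter_upwards [eventually_abs_lt_of_isCompact hb he hS₁ hε,
    eventually_abs_lt_of_isCompact hb he hS₂ hε] with n h1 h2
  refine max_le ((ContinuousMap.norm_le _ hε.le).2 fun x => ?_)
    ((ContinuousMap.norm_le _ hε.le).2 fun x => ?_)
  · have := (h1 _ ⟨x, rfl⟩).le
    rw [InnerProductSpace.toDual_apply_apply, real_inner_comm] at this
    exact this
  · set w : Euc d := ContinuousLinearMap.adjoint (k.deriv x) (y n) with hw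
    change ‖w‖ ≤ ε
    -- In the direction of `w` itself the pairing equals `‖w‖`; for `w = 0` the chosen vector is
    -- `0`, which still lies in the ball.
    have := (h2 _ ⟨(k.deriv x, ‖w‖⁻¹ • w), ⟨⟨x, rfl⟩, ?_⟩, rfl⟩).le
    · rw [InnerProductSpace.toDual_apply_apply, ← ContinuousLinearMap.adjoint_inner_left, ← hw,
        inner_smul_right, real_inner_self_eq_norm_sq] at this
      rcases eq_or_ne ‖w‖ 0 with h0 | h0
      · rw [h0]; exact hε.le
      · rwa [sq, inv_mul_cancel_left₀ h0, abs_of_nonneg (norm_nonneg _)] at this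
    · rw [mem_closedBall_zero_iff, norm_smul, norm_inv, norm_norm]
      exact inv_mul_le_one

/-- The lifted operator maps weakly* convergent sequences to norm convergent ones. -/
theorem tendsto_liftK {γ : ℝ≥0} (k : C1HolderKernel Ω Y γ) {h : ℕ → C1Dual Ω} {h₀ : C1Dual Ω}
    {M : ℝ} (hM : ∀ n, ‖h n‖ ≤ M) (hh : WeakStarTendsto h h₀) :
    Tendsto (fun n => liftK k (h n)) atTop (𝓝 (liftK k h₀)) := by
  have hsub : ∀ n, liftK k (h n) = liftK k (h n - h₀) + liftK k h₀ := fun n => by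
    rw [← liftK_add, sub_add_cancel]
  have hM0 : 0 ≤ M := (norm_nonneg _).trans (hM 0)
  have hb : ∀ n, ‖h n - h₀‖ ≤ M + ‖h₀‖ := fun n => (norm_sub_le _ _).trans (by gcongr; exact hM n)
  have hweak : ∀ z, Tendsto (fun n => (h n - h₀) z) atTop (𝓝 0) := fun z => by
    simpa using (hh z).sub_const (h₀ z)
  suffices H : Tendsto (fun n => liftK k (h n - h₀)) atTop (𝓝 0) by
    simp_rw [hsub]
    simpa using H.add_const (liftK k h₀)
  -- With `e = h n - h₀`, one has `‖𝒦 e‖ ^ 2 = e (K_* 𝒦 e)`. As `𝒦 e` is bounded and weakly null,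
  -- the compactness of `K_*` sends it to a norm null sequence, and `e` is bounded.
  have hpre : Tendsto (fun n => ‖preK k (liftK k (h n - h₀))‖) atTop (𝓝 0) := by
    rw [Metric.tendsto_nhds]
    intro ε hε
    filter_upwards [eventually_norm_preK_le k (y := fun n => liftK k (h n - h₀))
      (M := (M + ‖h₀‖) * ‖preK k‖)
      (fun n => (norm_liftK_le k _).trans (by gcongr; exact hb n))
      (fun z => by simp_rw [inner_liftK]; exact hweak _) (half_pos hε)] with n hn
    rw [dist_zero_right, norm_norm]
    linarith
  have hsq : Tendsto (fun n => ‖liftK k (h n - h₀)‖ ^ 2) atTop (𝓝 0) := by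
    refine squeeze_zero (fun n => by positivity) (fun n => ?_)
      (by simpa using hpre.const_mul (M + ‖h₀‖))
    rw [← real_inner_self_eq_norm_sq, inner_liftK]
    exact (le_abs_self _).trans ((h n - h₀).le_of_opNorm_le (hb n) _)
  rw [tendsto_zero_iff_norm_tendsto_zero]
  have := hsq.sqrt
  simpa using this

end Compactness

end

end LiftedMeasures

namespace LiftedMeasures

noncomputable section

/-! ### Difference quotients and the two implications. -/

section Quotients

variable {d : ℕ} {Ω : TopologicalSpace.Compacts (Euc d)}
variable {Y : Type*} [NormedAddCommGroup Y] [InnerProductSpace ℝ Y] [CompleteSpace Y]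

/-- The second-order difference quotient of the lifted penalty term `G`. -/
def penaltyQuotient (α : ℝ) (u : Meas Ω) (p : C1 Ω) (t : ℝ) (g : C1Dual Ω) : EReal :=
  (liftG α (inj u + t • g) - liftG α (inj u) - ((t * g p : ℝ) : EReal)) /
    ((t ^ 2 / 2 : ℝ) : EReal)

/-- The quotient of the non-degeneracy condition. -/
def nonDegQuotient (α : ℝ) (u : Meas Ω) (p : C1 Ω) (t : ℝ) (g : C1Dual Ω) : EReal :=
  ((1 / t ^ 2 : ℝ) : EReal) * (liftG α (inj u + t • g) - liftG α (inj u)) -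
    ((1 / t * g p : ℝ) : EReal)

/-- The term with `dualVar` is exactly the first-order term of `L`, so it is absorbed into
`secondQuotient`. -/
theorem norm_difference_eq {γ : ℝ≥0} (k : C1HolderKernel Ω Y γ) (L : Y → ℝ) (α : ℝ)
    {u w : Meas Ω} {t : ℝ} (ht : 0 < t) {g : C1Dual Ω} (hw : inj u + t • g = inj w) :
    α * ‖w‖ - α * ‖u‖ - t * g (dualVar k L u) =
      objective k L α w - objective k L α u -
        t ^ 2 / 2 * secondQuotient L (opK k u) t (liftK k g) := by
  have h1 : opK k w = opK k u + t • liftK k g := by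
    rw [← liftK_inj, ← hw, liftK_add, liftK_smul, liftK_inj]
  have h2 : g (dualVar k L u) = -inner ℝ (gradient L (opK k u)) (liftK k g) := by
    rw [dualVar, map_neg, ← inner_liftK, real_inner_comm]
  have ht2 : t ^ 2 / 2 ≠ 0 := by positivity
  rw [objective, objective, secondQuotient, mul_div_cancel₀ _ ht2, h1, h2]
  ring

theorem penaltyQuotient_eq {γ : ℝ≥0} (k : C1HolderKernel Ω Y γ) (L : Y → ℝ) (α : ℝ)
    {u w : Meas Ω} {t : ℝ} (ht : 0 < t) {g : C1Dual Ω} (hw : inj u + t • g = inj w) :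
    penaltyQuotient α u (dualVar k L u) t g =
      (((objective k L α w - objective k L α u) / (t ^ 2 / 2) -
        secondQuotient L (opK k u) t (liftK k g) : ℝ) : EReal) := by
  rw [penaltyQuotient, hw, liftG_inj, liftG_inj, ← EReal.coe_sub, ← EReal.coe_sub,
    ← EReal.coe_div, norm_difference_eq k L α ht hw]
  congr 1
  field_simp

theorem nonDegQuotient_eq {γ : ℝ≥0} (k : C1HolderKernel Ω Y γ) (L : Y → ℝ) (α : ℝ)
    {u w : Meas Ω} {t : ℝ} (ht : 0 < t) {g : C1Dual Ω} (hw : inj u + t • g = inj w) :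
    nonDegQuotient α u (dualVar k L u) t g =
      (((objective k L α w - objective k L α u) / t ^ 2 -
        secondQuotient L (opK k u) t (liftK k g) / 2 : ℝ) : EReal) := by
  rw [nonDegQuotient, hw, liftG_inj, liftG_inj, ← EReal.coe_sub, ← EReal.coe_mul,
    ← EReal.coe_sub]
  congr 1
  have h := norm_difference_eq k L α ht hw
  have h3 : 1 / t ^ 2 * (α * ‖w‖ - α * ‖u‖) - 1 / t * g (dualVar k L u) =
      1 / t ^ 2 * (α * ‖w‖ - α * ‖u‖ - t * g (dualVar k L u)) := by
    field_simp
  rw [h3, h]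
  field_simp

theorem penaltyQuotient_eq_top (α : ℝ) (u : Meas Ω) (p : C1 Ω) {t : ℝ} (ht : 0 < t)
    {g : C1Dual Ω} (hw : ¬ ∃ w : Meas Ω, inj w = inj u + t • g) :
    penaltyQuotient α u p t g = ⊤ := by
  rw [penaltyQuotient, liftG_eq_top α hw, liftG_inj, EReal.top_sub_coe, EReal.top_sub_coe,
    EReal.top_div_of_pos_ne_top (EReal.coe_pos.2 (by positivity)) (EReal.coe_ne_top _)]

theorem nonDegQuotient_eq_top (α : ℝ) (u : Meas Ω) (p : C1 Ω) {t : ℝ} (ht : 0 < t)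
    {g : C1Dual Ω} (hw : ¬ ∃ w : Meas Ω, inj w = inj u + t • g) :
    nonDegQuotient α u p t g = ⊤ := by
  rw [nonDegQuotient, liftG_eq_top α hw, liftG_inj, EReal.top_sub_coe,
    EReal.coe_mul_top_of_pos (by positivity), EReal.top_sub_coe]

/-- Quadratic growth, formulated in `C¹(Ω)*`. -/
theorem QuadraticGrowth.exists_lifted {γ : ℝ≥0} {k : C1HolderKernel Ω Y γ} {L : Y → ℝ} {α : ℝ}
    {u : Meas Ω} (hΩ : closure (interior (Ω : Set (Euc d))) = Ω)
    (hΩq : UniformlyLocallyQuasiconvex (interior (Ω : Set (Euc d))))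
    (hQ : QuadraticGrowth k L α u) :
    ∃ c : ℝ, 0 < c ∧ ∃ ε : ℝ, 0 < ε ∧ ∀ (t : ℝ) (g : C1Dual Ω) (w : Meas Ω), 0 < t →
      inj u + t • g = inj w → t * ‖g‖ ≤ ε →
      c * ‖g‖ ^ 2 * t ^ 2 ≤ objective k L α w - objective k L α u := by
  obtain ⟨M, hM, hMle⟩ := exists_norm_inj_le hΩ hΩq
  obtain ⟨c, hc, ε, hε, hgrow⟩ := hQ
  have hM0 : 0 < M := by linarith
  refine ⟨c / M ^ 2, by positivity, ε, hε, fun t g w ht hw hle => ?_⟩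
  have hdiff : inj (w - u) = t • g := by rw [inj_sub, ← hw, add_sub_cancel_left]
  have hnorm : ‖inj (w - u)‖ = t * ‖g‖ := by
    rw [hdiff, norm_smul, Real.norm_of_nonneg ht.le]
  refine le_trans ?_ (hgrow w ((blNorm_le_norm_inj _).trans (hnorm.trans_le hle)))
  have h1 := hMle (w - u)
  rw [hnorm] at h1
  calc c / M ^ 2 * ‖g‖ ^ 2 * t ^ 2 = c / M ^ 2 * (t * ‖g‖) ^ 2 := by ring
    _ ≤ c / M ^ 2 * (M * blNorm (w - u)) ^ 2 := by gcongr
    _ = c * blNorm (w - u) ^ 2 := by field_simp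

theorem QuadraticGrowth.secondOrderCondition {γ : ℝ≥0} {k : C1HolderKernel Ω Y γ} {L : Y → ℝ}
    (hL : ContDiff ℝ 2 L) {α : ℝ} {u : Meas Ω}
    (hΩ : closure (interior (Ω : Set (Euc d))) = Ω)
    (hΩq : UniformlyLocallyQuasiconvex (interior (Ω : Set (Euc d))))
    (hQ : QuadraticGrowth k L α u) : SecondOrderCondition k L α u := by
  obtain ⟨c, hc, ε, hε, hgrow⟩ := hQ.exists_lifted hΩ hΩq
  intro h hh
  have hh0 : 0 < ‖h‖ := norm_pos_iff.2 hh
  set H := hessForm L (opK k u) (liftK k h) with hH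
  set b : ℝ := c * (‖h‖ / 2) ^ 2 with hb
  have hb0 : 0 < b := by positivity
  have hle : ((b - H : ℝ) : EReal) ≤
      weakStarSecondSubderiv (liftG α) (inj u) (dualVar k L u) h := by
    refine le_sInf ?_
    rintro _ ⟨t, g, ht, ht0, hg, rfl⟩
    obtain ⟨M, hM⟩ := hg.exists_norm_le
    have hK := tendsto_liftK k hM hg
    have hS := tendsto_secondQuotient hL (opK k u) ht ht0 hK
    have htM : Tendsto (fun n => t n * M) atTop (𝓝 0) := by simpa using ht0.mul_const M
    refine le_liminf_of_le (by isBoundedDefault) ?_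
    -- Eventually `‖g n‖ > ‖h‖ / 2`, so the objective quotient is at least `2 * b`, while the
    -- quotient of `L` stays below `H + b`; the difference exceeds `b - H`.
    filter_upwards [hg.eventually_lt_norm (half_lt_self hh0), htM.eventually (ge_mem_nhds hε),
      hS.eventually (gt_mem_nhds (show H < H + b by linarith))] with n h1 h2 h3
    change _ ≤ penaltyQuotient α u (dualVar k L u) (t n) (g n)
    by_cases hw : ∃ w : Meas Ω, inj w = inj u + t n • g n
    · obtain ⟨w, hw⟩ := hw
      rw [penaltyQuotient_eq k L α (ht n) hw.symm, EReal.coe_le_coe_iff]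
      have h4 := hgrow (t n) (g n) w (ht n) hw.symm
        ((mul_le_mul_of_nonneg_left (hM n) (ht n).le).trans h2)
      have htn := ht n
      have h5 : 2 * b ≤ (objective k L α w - objective k L α u) / (t n ^ 2 / 2) := by
        rw [le_div_iff₀ (by positivity)]
        calc 2 * b * (t n ^ 2 / 2) = c * (‖h‖ / 2) ^ 2 * t n ^ 2 := by rw [hb]; ring
          _ ≤ c * ‖g n‖ ^ 2 * t n ^ 2 := by gcongr
          _ ≤ _ := h4
      linarith
    · rw [penaltyQuotient_eq_top α u _ (ht n) hw]
      exact le_top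
  calc (0 : EReal) < ((H + (b - H) : ℝ) : EReal) := by
        rw [EReal.coe_pos]; linarith
    _ = (H : EReal) + ((b - H : ℝ) : EReal) := EReal.coe_add _ _
    _ ≤ _ := by gcongr

theorem QuadraticGrowth.nonDegeneracyCondition {γ : ℝ≥0} {k : C1HolderKernel Ω Y γ} {L : Y → ℝ}
    (hL : ContDiff ℝ 2 L) {α : ℝ} {u : Meas Ω}
    (hΩ : closure (interior (Ω : Set (Euc d))) = Ω)
    (hΩq : UniformlyLocallyQuasiconvex (interior (Ω : Set (Euc d))))
    (hQ : QuadraticGrowth k L α u) : NonDegeneracyCondition k L α u := by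
  obtain ⟨c, hc, ε, hε, hgrow⟩ := hQ.exists_lifted hΩ hΩq
  intro t g ht ht0 hg hg1
  have hK := tendsto_liftK k (fun n => (hg1 n).le) hg
  have hS := tendsto_secondQuotient hL (opK k u) ht ht0 hK
  have hH : hessForm L (opK k u) (liftK k (0 : C1Dual Ω)) = 0 := by
    have : liftK k (0 : C1Dual Ω) = 0 := by simpa using liftK_smul k 0 0
    simp [this, hessForm]
  rw [hH] at hS
  refine lt_of_lt_of_le (EReal.coe_pos.2 (half_pos hc)) (le_liminf_of_le (by isBoundedDefault) ?_)
  -- The objective quotient is at least `c`, and half the quotient of `L` is eventually below `c /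
  -- 2`, as its limit is `0`.
  filter_upwards [ht0.eventually (ge_mem_nhds hε), hS.eventually (gt_mem_nhds hc)] with n h2 h3
  change _ ≤ nonDegQuotient α u (dualVar k L u) (t n) (g n)
  by_cases hw : ∃ w : Meas Ω, inj w = inj u + t n • g n
  · obtain ⟨w, hw⟩ := hw
    rw [nonDegQuotient_eq k L α (ht n) hw.symm, EReal.coe_le_coe_iff]
    have h4 := hgrow (t n) (g n) w (ht n) hw.symm (by rw [hg1, mul_one]; exact h2)
    have htn := ht n
    have h5 : c ≤ (objective k L α w - objective k L α u) / t n ^ 2 := by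
      rw [le_div_iff₀ (by positivity)]
      simpa [hg1] using h4
    linarith
  · rw [nonDegQuotient_eq_top α u _ (ht n) hw]
    exact le_top

theorem quadraticGrowth_of_conditions {γ : ℝ≥0} {k : C1HolderKernel Ω Y γ} {L : Y → ℝ}
    (hL : ContDiff ℝ 2 L) {α : ℝ} {u : Meas Ω}
    (hΩ : closure (interior (Ω : Set (Euc d))) = Ω)
    (hΩq : UniformlyLocallyQuasiconvex (interior (Ω : Set (Euc d))))
    (hS : SecondOrderCondition k L α u) (hN : NonDegeneracyCondition k L α u) :
    QuadraticGrowth k L α u := by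
  obtain ⟨M, hM, hMle⟩ := exists_norm_inj_le hΩ hΩq
  by_contra hQ
  have hseq : ∀ n : ℕ, ∃ w : Meas Ω, blNorm (w - u) ≤ 1 / ((n : ℝ) + 1) ∧
      objective k L α w - objective k L α u < 1 / ((n : ℝ) + 1) * blNorm (w - u) ^ 2 := by
    intro n
    by_contra! h
    exact hQ ⟨1 / ((n : ℝ) + 1), by positivity, 1 / ((n : ℝ) + 1), by positivity, h⟩
  choose w hw1 hw2 using hseq
  -- Step lengths are measured in the dual norm, so that the directions `g n` are unit vectors. They
  -- are positive because the strict inequality `hw2` excludes `w n = u`.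
  set t : ℕ → ℝ := fun n => ‖inj (w n - u)‖ with htdef
  have ht : ∀ n, 0 < t n := by
    intro n
    refine norm_pos_iff.2 fun h0 => ?_
    have h1 : w n - u = 0 := inj_injective (h0.trans (by ext φ; simp [inj_apply]))
    have h2 := hw2 n
    have h3 : blNorm (w n - u) ^ 2 ≤ 0 := by
      have h4 : blNorm (w n - u) ≤ 0 := by simpa [h0] using blNorm_le_norm_inj (w n - u)
      have h5 := blNorm_nonneg (w n - u)
      rw [le_antisymm h4 h5]; simp
    rw [sub_eq_zero.1 h1] at h2 h3
    have h6 : 1 / ((n : ℝ) + 1) * blNorm (u - u) ^ 2 ≤ 0 :=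
      mul_nonpos_of_nonneg_of_nonpos (by positivity) h3
    linarith
  set g : ℕ → C1Dual Ω := fun n => (t n)⁻¹ • inj (w n - u) with hgdef
  have hg1 : ∀ n, ‖g n‖ = 1 := fun n => by
    rw [hgdef, norm_smul, norm_inv, Real.norm_of_nonneg (ht n).le, inv_mul_cancel₀ (ht n).ne']
  have hwg : ∀ n, inj u + t n • g n = inj (w n) := fun n => by
    rw [hgdef, smul_inv_smul₀ (ht n).ne', inj_sub, add_sub_cancel]
  have ht0 : Tendsto t atTop (𝓝 0) := by
    refine squeeze_zero (fun n => (ht n).le)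
      (fun n => (hMle _).trans (mul_le_mul_of_nonneg_left (hw1 n) (by linarith))) ?_
    simpa using (tendsto_one_div_add_atTop_nhds_zero_nat (𝕜 := ℝ)).const_mul M
  have hJ : ∀ n, (objective k L α (w n) - objective k L α u) / t n ^ 2 ≤ 1 / ((n : ℝ) + 1) := by
    intro n
    rw [div_le_iff₀ (pow_pos (ht n) 2)]
    refine (hw2 n).le.trans ?_
    gcongr
    exacts [blNorm_nonneg _, blNorm_le_norm_inj _]
  obtain ⟨h, ν, hν, hlim⟩ := exists_weakStar_subseq hg1
  have htν : Tendsto (t ∘ ν) atTop (𝓝 0) := ht0.comp hν.tendsto_atTop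
  have hK := tendsto_liftK k (h := g ∘ ν) (fun n => (hg1 (ν n)).le) hlim
  have hT := tendsto_secondQuotient hL (opK k u) (t := t ∘ ν) (fun n => ht (ν n)) htν hK
  have hone : Tendsto (fun n => 1 / ((ν n : ℝ) + 1)) atTop (𝓝 0) :=
    (tendsto_one_div_add_atTop_nhds_zero_nat (𝕜 := ℝ)).comp hν.tendsto_atTop
  by_cases hh : h = 0
  · have hpos := hN (t ∘ ν) (g ∘ ν) (fun n => ht (ν n)) htν (hh ▸ hlim) (fun n => hg1 (ν n))
    refine hpos.not_ge ?_
    have hH : hessForm L (opK k u) (liftK k h) = 0 := by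
      have : liftK k (0 : C1Dual Ω) = 0 := by simpa using liftK_smul k 0 0
      simp [hh, this, hessForm]
    rw [hH] at hT
    have hup : Tendsto (fun n => (((1 / ((ν n : ℝ) + 1) -
        secondQuotient L (opK k u) (t (ν n)) (liftK k (g (ν n))) / 2 : ℝ)) : EReal)) atTop
        (𝓝 ((0 : ℝ) : EReal)) := by
      refine (continuous_coe_real_ereal.tendsto _).comp ?_
      simpa using hone.sub (hT.div_const 2)
    refine le_of_le_of_eq (liminf_le_liminf (Eventually.of_forall fun n => ?_)) hup.liminf_eq
    change nonDegQuotient α u (dualVar k L u) (t (ν n)) (g (ν n)) ≤ _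
    rw [nonDegQuotient_eq k L α (ht (ν n)) (hwg (ν n)), EReal.coe_le_coe_iff]
    linarith [hJ (ν n)]
  -- The subsequence competes in the infimum defining the second subderivative, and its quotients
  -- are at most a sequence tending to `-H`.
  · refine (hS h hh).not_ge ?_
    set H := hessForm L (opK k u) (liftK k h) with hHdef
    have hup : Tendsto (fun n => (((2 * (1 / ((ν n : ℝ) + 1)) -
        secondQuotient L (opK k u) (t (ν n)) (liftK k (g (ν n))) : ℝ)) : EReal)) atTop
        (𝓝 ((-H : ℝ) : EReal)) := by
      refine (continuous_coe_real_ereal.tendsto _).comp ?_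
      simpa using (hone.const_mul 2).sub hT
    have hle : weakStarSecondSubderiv (liftG α) (inj u) (dualVar k L u) h ≤ ((-H : ℝ) : EReal) := by
      refine (weakStarSecondSubderiv_le _ _ _ (fun n => ht (ν n)) htν hlim).trans ?_
      refine le_of_le_of_eq (liminf_le_liminf (Eventually.of_forall fun n => ?_)) hup.liminf_eq
      change penaltyQuotient α u (dualVar k L u) (t (ν n)) (g (ν n)) ≤ _
      rw [penaltyQuotient_eq k L α (ht (ν n)) (hwg (ν n)), EReal.coe_le_coe_iff]
      have h1 := hJ (ν n)
      have h2 : (objective k L α (w (ν n)) - objective k L α u) / (t (ν n) ^ 2 / 2) =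
          2 * ((objective k L α (w (ν n)) - objective k L α u) / t (ν n) ^ 2) := by
        rw [div_div_eq_mul_div]; ring
      linarith
    calc _ ≤ (H : EReal) + ((-H : ℝ) : EReal) := by gcongr
      _ = 0 := by rw [← EReal.coe_add]; simp

end Quotients

end

end LiftedMeasures

theorem corollary5p14 {d : ℕ} (hd : 0 < d) (Ω : TopologicalSpace.Compacts (LiftedMeasures.Euc d))
    (hΩ : closure (interior (Ω : Set (LiftedMeasures.Euc d))) = Ω)
    (hΩq : LiftedMeasures.UniformlyLocallyQuasiconvex
      (interior (Ω : Set (LiftedMeasures.Euc d))))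
    {Y : Type*} [NormedAddCommGroup Y] [InnerProductSpace ℝ Y] [CompleteSpace Y]
    [TopologicalSpace.SeparableSpace Y]
    (L : Y → ℝ) (hL : ContDiff ℝ 2 L)
    (γ : ℝ≥0) (hγ0 : 0 < γ) (hγ1 : γ ≤ 1)
    (k : LiftedMeasures.C1HolderKernel Ω Y γ)
    (α : ℝ) (hα : 0 < α)
    (u : LiftedMeasures.Meas Ω) :
    (LiftedMeasures.SecondOrderCondition k L α u ∧
      LiftedMeasures.NonDegeneracyCondition k L α u) ↔
    LiftedMeasures.QuadraticGrowth k L α u :=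
  ⟨fun h => LiftedMeasures.quadraticGrowth_of_conditions hL hΩ hΩq h.1 h.2,
    fun h => ⟨h.secondOrderCondition hL hΩ hΩq, h.nonDegeneracyCondition hL hΩ hΩq⟩⟩
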